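/- Let $\mathbb{F}_q$ be a finite field, $m_1,\dots,m_\ell$ positive integers, $n=m_1+\cdots+m_\ell$, and $\Lambda=(\lambda_1,\dots,\lambda_\ell)$ with all $\lambda_i\in\mathbb{F}_q$ nonzero. A $\Lambda$-multi-twisted ($\Lambda$-MT) code of index $\ell$ and block lengths $(m_1,\dots,m_\ell)$ is an $\mathbb{F}_q[x]$-submodule of $(\mathbb{F}_q[x])^\ell$ that contains $M_\Lambda=\bigoplus_{i=1}^{\ell}(x^{m_i}-\lambda_i)\mathbb{F}_q[x]$; it is identified with the linear code in $\mathbb{F}_q^n$ obtained by reducing the $i$-th entry modulo $x^{m_i}-\lambda_i$ and listing the $m_i$ coefficients of the remainder as the $i$-th block. A generator polynomial matrix (GPM) of such a code is a matrix over $\mathbb{F}_q[x]$ whose rows generate the submodule. The reduced GPM is the one in Hermite normal form: the $\ell\times\ell$ upper triangular GPM $\mathbf{G}=[g_{i,j}]$ with every $g_{i,i}$ monic and $\deg g_{h,i}<\deg g_{i,i}$ for $h<i$ (where $\deg 0=-\infty$). Let $\mathcal{C}$ be a $\Lambda$-MT code with reduced GPM $\mathbf{G}$, let $\mathbf{A}=[a_{i,j}]$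 be the matrix over $\mathbb{F}_q[x]$ with $\mathbf{A}\mathbf{G}=\mathrm{diag}[x^{m_1}-\lambda_1,\dots,x^{m_\ell}-\lambda_\ell]$, and let $d_j=\deg g_{j,j}$. Let $\mathbf{A}^*$ be the matrix of Laurent polynomials with $(i,j)$-th entry $x^{m_i-d_j}\,a_{i,j}(1/x)$. Let $\mathbf{A}^{**}$ be obtained from $\mathbf{A}^*$ by reducing each entry with $i<j$ modulo $x^{m_i}-\frac{1}{\lambda_i}$ to a polynomial of degree less than $m_i$ (that is, $x^{k}$, $k\in\mathbb{Z}$, is replaced by $\lambda_i^{-\lfloor k/m_i\rfloor}x^{k\bmod m_i}$), and leaving the entries with $i\ge j$ unchanged. Theorem. The entries of $\mathbf{A}^*$ with $i\ge j$ are polynomials, so that $\mathbf{A}^{**}$ is a polynomial matrix, and $\mathbf{H}=(\mathbf{A}^{**})^t$ is a GPM of the Euclidean dual $\mathcal{C}^\perp\subseteq\mathbb{F}_q^n$, regarded as a $\Delta$-MT code of the same block lengths with $\Delta=\left(\frac{1}{\lambda_1},\dots,\frac{1}{\lambda_\ell}\right)$. -/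

import Mathlib

open Polynomial LaurentPolynomial

namespace MultiTwisted

noncomputable section

/-- The submodule `⨁ᵢ (x ^ mᵢ - λᵢ) F[x]` of `F[x] ^ ℓ`. -/
def blockSubmodule {F : Type*} [Field F] {ℓ : ℕ} (m : Fin ℓ → ℕ) (lam : Fin ℓ → F) :
    Submodule F[X] (Fin ℓ → F[X]) :=
  Submodule.pi Set.univ fun i => Ideal.span {(X ^ m i - Polynomial.C (lam i) : F[X])}

/-- A `Λ`-multi-twisted code of index `ℓ` and block lengths `m`, as a submodule of `F[x] ^ ℓ`. -/
def IsMTCode {F : Type*} [Field F] {ℓ : ℕ} (m : Fin ℓ → ℕ) (lam : Fin ℓ → F)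
    (code : Submodule F[X] (Fin ℓ → F[X])) : Prop :=
  blockSubmodule m lam ≤ code

/-- The map `F[x] ^ ℓ → ⨁ᵢ F[x] / (x ^ mᵢ - λᵢ) ≃ F ^ n` with `n = ∑ᵢ mᵢ`: coordinate `k` of
block `i` is the coefficient of `x ^ k` in the remainder of the `i`-th entry. -/
def toWord {F : Type*} [Field F] {ℓ : ℕ} (m : Fin ℓ → ℕ) (lam : Fin ℓ → F) :
    (Fin ℓ → F[X]) →ₗ[F] ((Σ i : Fin ℓ, Fin (m i)) → F) :=
  LinearMap.pi fun p =>
    lcoeff F (p.2 : ℕ) ∘ₗ modByMonicHom (X ^ m p.1 - Polynomial.C (lam p.1) : F[X]) ∘ₗ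
      LinearMap.proj p.1

/-- The subspace of `F ^ n` that corresponds to a multi-twisted code given as a submodule of
`F[x] ^ ℓ`. -/
def wordCode {F : Type*} [Field F] {ℓ : ℕ} (m : Fin ℓ → ℕ) (lam : Fin ℓ → F)
    (code : Submodule F[X] (Fin ℓ → F[X])) : Submodule F ((Σ i : Fin ℓ, Fin (m i)) → F) :=
  (code.restrictScalars F).map (toWord m lam)

/-- The Euclidean dual of a linear code. -/
def euclideanDual {F : Type*} [Field F] {κ : Type*} [Fintype κ] (W : Submodule F (κ → F)) :
    Submodule F (κ → F) where
  carrier := {a | ∀ c ∈ W, a ⬝ᵥ c = 0}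
  zero_mem' := fun c _ => zero_dotProduct c
  add_mem' := fun ha hb c hc => by rw [add_dotProduct, ha c hc, hb c hc, add_zero]
  smul_mem' := fun r a ha c hc => by rw [smul_dotProduct, ha c hc, smul_zero]

/-- `G` is a generator polynomial matrix (GPM): its rows generate `code` over `F[x]`. -/
def IsGPM {F : Type*} [Field F] {ℓ : ℕ} (G : Matrix (Fin ℓ) (Fin ℓ) F[X])
    (code : Submodule F[X] (Fin ℓ → F[X])) : Prop :=
  Submodule.span F[X] (Set.range fun i => G i) = code

/-- `G` is the reduced GPM of `code`, i.e. a GPM in Hermite normal form. -/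
structure IsReducedGPM {F : Type*} [Field F] {ℓ : ℕ} (G : Matrix (Fin ℓ) (Fin ℓ) F[X])
    (code : Submodule F[X] (Fin ℓ → F[X])) : Prop where
  isGPM : IsGPM G code
  upper : ∀ i j, j < i → G i j = 0
  monic : ∀ i, (G i i).Monic
  degree_lt : ∀ h i, h < i → (G h i).degree < (G i i).degree

/-- `H` is a GPM of the linear code `W ⊆ F ^ n`, regarded as a `Λ`-multi-twisted code: there is a
(necessarily unique) `Λ`-multi-twisted submodule of `F[x] ^ ℓ` that corresponds to `W`, and the
rows of `H` generate it. -/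
def IsGPMOfWordCode {F : Type*} [Field F] {ℓ : ℕ} (m : Fin ℓ → ℕ) (lam : Fin ℓ → F)
    (H : Matrix (Fin ℓ) (Fin ℓ) F[X]) (W : Submodule F ((Σ i : Fin ℓ, Fin (m i)) → F)) : Prop :=
  ∃ code : Submodule F[X] (Fin ℓ → F[X]),
    IsMTCode m lam code ∧ wordCode m lam code = W ∧ IsGPM H code

/-- `D = diag(x ^ mᵢ - λᵢ)`. -/
def blockDiagonal {F : Type*} [Field F] {ℓ : ℕ} (m : Fin ℓ → ℕ) (lam : Fin ℓ → F) :
    Matrix (Fin ℓ) (Fin ℓ) F[X] :=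
  Matrix.diagonal fun i => X ^ m i - Polynomial.C (lam i)

/-- `A*`: entry `(i, j)` of `A(1/x)` multiplied by `x ^ (mᵢ - dⱼ)`, where `dⱼ = deg gⱼⱼ`. -/
def starMatrix {F : Type*} [Field F] {ℓ : ℕ} (m : Fin ℓ → ℕ)
    (G A : Matrix (Fin ℓ) (Fin ℓ) F[X]) : Matrix (Fin ℓ) (Fin ℓ) F[T;T⁻¹] :=
  Matrix.of fun i j =>
    T ((m i : ℤ) - ((G j j).natDegree : ℤ)) * invert (toLaurent (A i j))

/-- The reduction of a Laurent polynomial modulo `x ^ m - c` (for `m > 0`, `c ≠ 0`), a polynomial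
of degree less than `m`: the power `x ^ k`, `k ∈ ℤ`, is replaced by `c ^ ⌊k / m⌋ x ^ (k mod m)`. -/
def laurentMod {F : Type*} [Field F] (m : ℕ) (c : F) (f : F[T;T⁻¹]) : F[X] :=
  f.coeff.sum fun k a => monomial (k % (m : ℤ)).toNat (a * c ^ (k / (m : ℤ)))

/-- `A**`: the entries of `A*` above the diagonal are reduced modulo `x ^ mᵢ - 1 / λᵢ`. The other
entries of `A*` are kept; those have no negative exponents when `A G = D` with `G` in Hermite
normal form, so that `trunc`, which forgets negative exponents, only views them as polynomials. -/
def doubleStarMatrix {F : Type*} [Field F] {ℓ : ℕ} (m : Fin ℓ → ℕ) (lam : Fin ℓ → F)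
    (G A : Matrix (Fin ℓ) (Fin ℓ) F[X]) : Matrix (Fin ℓ) (Fin ℓ) F[X] :=
  Matrix.of fun i j =>
    if i < j then laurentMod (m i) (lam i)⁻¹ (starMatrix m G A i j)
    else trunc (starMatrix m G A i j)

end

end MultiTwisted

namespace MultiTwisted

/-! ### Reduction of Laurent polynomials modulo `X ^ m - c` -/

section LaurentMod

variable {F : Type*} [Field F]

/-! Orthogonality plus a dimension count. The dot product of the words of `v` and `u` is the sum
over blocks of the constant coefficient of `v_i(1/x) u_i(x)` modulo `D_i = x^{m_i} - λ_i`. For `v =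
f • (row j of H)`, the relation `x^{m_i} ≡ λ_i` turns `v_i(1/x)` into `λ_i⁻¹ f(1/x) x^{d_j} a_ij`.
As `A G = D` gives `G D⁻¹ A = 1`, the sum `∑ a_ij u_i / D_i` is a polynomial for `u` in the row
space of `G`. Multiplying by `f(1/x) x^{d_j}` and reducing the numerators leaves a sum of proper
fractions `r_i / D_i` that is a polynomial, hence zero; its value at `0` is `-∑ λ_i⁻¹ r_i(0)`, so
the dot product vanishes (`toWord_row_dotProduct_toWord_eq_zero`). Both `G` and `H` are triangular,
so their row spaces have codimensions at most `∑ d_i` and `∑ (m_i - d_i)`. These bounds sum to `n`,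
which forces equality with the dual and puts the kernel of `toWord` inside the row space of `H`
(`map_eq_and_ker_le_of_finrank_le`). -/

theorem laurentMod_add (m : ℕ) (c : F) (f g : F[T;T⁻¹]) :
    laurentMod m c (f + g) = laurentMod m c f + laurentMod m c g := by
  unfold laurentMod
  rw [AddMonoidAlgebra.coeff_add]
  exact Finsupp.sum_add_index' (by simp) (by simp [add_mul])

theorem laurentMod_C_mul_T (m : ℕ) (c a : F) (k : ℤ) :
    laurentMod m c (LaurentPolynomial.C a * T k) =
      monomial (k % (m : ℤ)).toNat (a * c ^ (k / (m : ℤ))) := by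
  unfold laurentMod
  rw [← single_eq_C_mul_T, AddMonoidAlgebra.coeff_single, Finsupp.sum_single_index (by simp)]

theorem laurentMod_C_mul (m : ℕ) (c a : F) (f : F[T;T⁻¹]) :
    laurentMod m c (LaurentPolynomial.C a * f) = Polynomial.C a * laurentMod m c f := by
  induction f using LaurentPolynomial.induction_on' with
  | add p q hp hq => rw [mul_add, laurentMod_add, laurentMod_add, hp, hq, mul_add]
  | C_mul_T k b =>
    rw [← mul_assoc, ← map_mul, laurentMod_C_mul_T, laurentMod_C_mul_T, C_mul_monomial, mul_assoc]

theorem degree_laurentMod_lt {m : ℕ} (hm : 0 < m) (c : F) (f : F[T;T⁻¹]) :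
    (laurentMod m c f).degree < m := by
  induction f using LaurentPolynomial.induction_on' with
  | add p q hp hq =>
    rw [laurentMod_add]
    exact (degree_add_le _ _).trans_lt (max_lt hp hq)
  | C_mul_T k b =>
    rw [laurentMod_C_mul_T]
    refine (degree_monomial_le _ _).trans_lt ?_
    have h1 := Int.emod_nonneg k (b := (m : ℤ)) (by omega)
    have h2 := Int.emod_lt_of_pos k (b := (m : ℤ)) (by omega)
    exact_mod_cast (by omega : (k % (m : ℤ)).toNat < m)

theorem T_sub_C_dvd_T_mul_sub_C_zpow (m : ℕ) {c : F} (hc : c ≠ 0) (z : ℤ) :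
    (T (m : ℤ) - LaurentPolynomial.C c : F[T;T⁻¹]) ∣
      T ((m : ℤ) * z) - LaurentPolynomial.C (c ^ z) := by
  have hnat : ∀ n : ℕ, (T (m : ℤ) - LaurentPolynomial.C c : F[T;T⁻¹]) ∣
      T ((m : ℤ) * n) - LaurentPolynomial.C (c ^ n) := fun n => by
    have := sub_dvd_pow_sub_pow (T (m : ℤ) : F[T;T⁻¹]) (LaurentPolynomial.C c) n
    rwa [T_pow, ← map_pow, mul_comm (n : ℤ)] at this
  obtain ⟨n, rfl | rfl⟩ := z.eq_nat_or_neg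
  · exact_mod_cast hnat n
  -- With `y = T (m * n)` and `b = c ^ n`: `y⁻¹ - b⁻¹ = -(y - b) y⁻¹ b⁻¹`.
  · have h : (T ((m : ℤ) * -(n : ℤ)) - LaurentPolynomial.C (c ^ (-(n : ℤ))) : F[T;T⁻¹]) =
        (T ((m : ℤ) * n) - LaurentPolynomial.C (c ^ n)) *
          (-(T (-((m : ℤ) * n)) * LaurentPolynomial.C (c ^ (-(n : ℤ))))) := by
      have h1 : (T ((m : ℤ) * n) * T (-((m : ℤ) * n)) : F[T;T⁻¹]) = 1 := by
        rw [← T_add, add_neg_cancel, T_zero]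
      have h2 : (LaurentPolynomial.C (c ^ n) * LaurentPolynomial.C (c ^ (-(n : ℤ))) : F[T;T⁻¹])
          = 1 := by
        rw [← map_mul, zpow_neg, zpow_natCast, mul_inv_cancel₀ (pow_ne_zero _ hc), map_one]
      rw [mul_neg]
      linear_combination (LaurentPolynomial.C (c ^ (-(n : ℤ)))) * h1 - T (-((m : ℤ) * n)) * h2
    rw [h]
    exact (hnat n).mul_right _

theorem dvd_toLaurent_laurentMod_sub {m : ℕ} (hm : 0 < m) {c : F} (hc : c ≠ 0) (f : F[T;T⁻¹]) :
    (T (m : ℤ) - LaurentPolynomial.C c : F[T;T⁻¹]) ∣ toLaurent (laurentMod m c f) - f := by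
  induction f using LaurentPolynomial.induction_on' with
  | add p q hp hq =>
    rw [laurentMod_add, map_add, add_sub_add_comm]
    exact dvd_add hp hq
  | C_mul_T k b =>
    have hk : (k % (m : ℤ)).toNat = k % (m : ℤ) :=
      Int.toNat_of_nonneg (Int.emod_nonneg _ (by omega))
    have h : (T k : F[T;T⁻¹]) = T (k % (m : ℤ)) * T ((m : ℤ) * (k / (m : ℤ))) := by
      rw [← T_add, Int.emod_add_mul_ediv]
    rw [laurentMod_C_mul_T, toLaurent_C_mul_T, hk, h, map_mul, ← dvd_neg]
    convert! (T_sub_C_dvd_T_mul_sub_C_zpow m hc (k / (m : ℤ))).mul_left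
      (LaurentPolynomial.C b * T (k % (m : ℤ))) using 1
    ring

theorem laurentMod_mul_T_sub_C {m : ℕ} (hm : 0 < m) {c : F} (hc : c ≠ 0) (f : F[T;T⁻¹]) :
    laurentMod m c (f * (T (m : ℤ) - LaurentPolynomial.C c)) = 0 := by
  induction f using LaurentPolynomial.induction_on' with
  | add p q hp hq => rw [add_mul, laurentMod_add, hp, hq, add_zero]
  | C_mul_T k b =>
    have h : (LaurentPolynomial.C b * T k * (T (m : ℤ) - LaurentPolynomial.C c) : F[T;T⁻¹]) =
        LaurentPolynomial.C b * T (k + m) + LaurentPolynomial.C (-(b * c)) * T k := by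
      rw [T_add, map_neg, map_mul]
      ring
    rw [h, laurentMod_add, laurentMod_C_mul_T, laurentMod_C_mul_T, Int.add_emod_right,
      Int.add_ediv_of_dvd_right (dvd_refl _), Int.ediv_self (by omega), ← map_add,
      zpow_add_one₀ hc]
    rw [show ∀ z : F, b * (z * c) + -(b * c) * z = 0 by intro z; ring, monomial_zero_right]

theorem laurentMod_eq_of_dvd_sub {m : ℕ} (hm : 0 < m) {c : F} (hc : c ≠ 0) {f g : F[T;T⁻¹]}
    (h : (T (m : ℤ) - LaurentPolynomial.C c : F[T;T⁻¹]) ∣ f - g) :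
    laurentMod m c f = laurentMod m c g := by
  obtain ⟨e, he⟩ := h
  rw [sub_eq_iff_eq_add.1 he, mul_comm, laurentMod_add, laurentMod_mul_T_sub_C hm hc, zero_add]

theorem toLaurent_X_pow_sub_C (m : ℕ) (c : F) :
    toLaurent (X ^ m - Polynomial.C c) = (T (m : ℤ) - LaurentPolynomial.C c : F[T;T⁻¹]) := by
  simp

/-- Clearing negative exponents costs a power of `X`, which is coprime to `p` because `p(0) ≠ 0`. -/
theorem dvd_of_toLaurent_dvd_toLaurent {p q : F[X]} (hp : p.coeff 0 ≠ 0)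
    (h : toLaurent p ∣ toLaurent q) : p ∣ q := by
  obtain ⟨g, hg⟩ := h
  obtain ⟨n, g', hg'⟩ := exists_T_pow g
  have h1 : q * X ^ n = p * g' := by
    apply toLaurent_injective
    rw [map_mul, map_mul, hg', hg, toLaurent_X_pow, mul_assoc]
  have h2 : IsCoprime p (X ^ n) :=
    (((irreducible_X (R := F)).coprime_iff_not_dvd.2 fun h => hp (X_dvd_iff.1 h)).symm).pow_right
  exact h2.dvd_of_dvd_mul_right ⟨g', h1⟩

theorem laurentMod_toLaurent {m : ℕ} (hm : 0 < m) {c : F} (hc : c ≠ 0) (p : F[X]) :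
    laurentMod m c (toLaurent p) = p %ₘ (X ^ m - Polynomial.C c) := by
  have hmonic : (X ^ m - Polynomial.C c : F[X]).Monic := monic_X_pow_sub_C c hm.ne'
  have hdvd : (X ^ m - Polynomial.C c : F[X]) ∣ p - laurentMod m c (toLaurent p) := by
    apply dvd_of_toLaurent_dvd_toLaurent
    · simp [coeff_X_pow, hm.ne, hc]
    · rw [toLaurent_X_pow_sub_C, map_sub, ← dvd_neg, neg_sub]
      exact dvd_toLaurent_laurentMod_sub hm hc _
  obtain ⟨q, hq⟩ := hdvd
  refine ((div_modByMonic_unique q _ hmonic ⟨?_, ?_⟩).2).symm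
  · rw [← hq, add_sub_cancel]
  · rw [degree_X_pow_sub_C hm]
    exact degree_laurentMod_lt hm _ _

/-- The dot product of two remainders is the constant coefficient of the reduction of
`v(1/x) u(x)`. -/
theorem sum_coeff_laurentMod_mul_coeff_laurentMod {m : ℕ} (hm : 0 < m) {c : F} (hc : c ≠ 0)
    (v u : F[T;T⁻¹]) :
    ∑ k : Fin m, (laurentMod m c⁻¹ v).coeff k * (laurentMod m c u).coeff k =
      (laurentMod m c (invert v * u)).coeff 0 := by
  induction v using LaurentPolynomial.induction_on' with
  | add p q hp hq =>
    simp only [laurentMod_add, coeff_add, add_mul, Finset.sum_add_distrib, hp, hq, map_add]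
  | C_mul_T a b =>
  induction u using LaurentPolynomial.induction_on' with
  | add p q hp hq =>
    simp only [laurentMod_add, coeff_add, mul_add, Finset.sum_add_distrib, hp, hq]
  | C_mul_T a' b' =>
    have hm' : (m : ℤ) ≠ 0 := by omega
    have h : (invert (LaurentPolynomial.C b * T a) * (LaurentPolynomial.C b' * T a') : F[T;T⁻¹]) =
        LaurentPolynomial.C (b * b') * T (a' - a) := by
      rw [map_mul, invert_C, invert_T, T_sub, map_mul]
      ring
    have ha := Int.emod_nonneg a hm'
    have ha' := Int.emod_nonneg a' hm'
    have haa := Int.emod_nonneg (a' - a) hm'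
    have hlt := Int.emod_lt_of_pos a (b := (m : ℤ)) (by omega)
    rw [h, laurentMod_C_mul_T, laurentMod_C_mul_T, laurentMod_C_mul_T]
    simp only [coeff_monomial]
    -- Only one index can contribute, and it does so exactly when `a ≡ a'` modulo `m`.
    rw [Finset.sum_eq_single (⟨(a % (m : ℤ)).toNat, by omega⟩ : Fin m)]
    · by_cases hd : a' % (m : ℤ) = a % (m : ℤ)
      · have hdvd : (m : ℤ) ∣ a' - a := Int.ModEq.dvd hd.symm
        have hq : (a' - a) / (m : ℤ) = a' / m - a / m := by
          have h1 := Int.emod_add_mul_ediv a m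
          have h2 := Int.emod_add_mul_ediv a' m
          apply Int.ediv_eq_of_eq_mul_right hm'
          rw [mul_sub]
          omega
        rw [if_pos rfl, if_pos (by simp [hd]), if_pos (by simp [Int.emod_eq_zero_of_dvd hdvd]), hq,
          zpow_sub₀ hc, inv_zpow]
        ring
      · rw [if_pos rfl, if_neg (by simp only; omega), mul_zero, if_neg]
        intro h0
        have h1 : (a' - a) % (m : ℤ) = 0 := by omega
        exact hd (Int.ModEq.symm ((Int.modEq_iff_dvd).2 (Int.dvd_of_emod_eq_zero h1)))
    · intro k _ hk
      rw [if_neg, zero_mul]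
      exact fun h => hk (Fin.ext h.symm)
    · simp

end LaurentMod

/-! ### Sums of proper fractions -/

section ProperFractions

variable {F : Type*} [Field F] {ι : Type*} [Fintype ι] [DecidableEq ι]

/-- After clearing denominators, `h` says that `∑ r_i / (X ^ m_i - c_i)` is a polynomial. Being
proper, it is zero; evaluate at `0`. -/
theorem sum_inv_mul_coeff_zero_eq_zero {m : ι → ℕ} (hm : ∀ i, 0 < m i) {c : ι → F}
    (hc : ∀ i, c i ≠ 0) {r : ι → F[X]} (hr : ∀ i, (r i).degree < m i)
    (h : (∏ k, (X ^ m k - Polynomial.C (c k)) : F[X]) ∣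
      ∑ i, r i * ∏ k ∈ Finset.univ.erase i, (X ^ m k - Polynomial.C (c k))) :
    ∑ i, (c i)⁻¹ * (r i).coeff 0 = 0 := by
  have hmonic : ∀ k, (X ^ m k - Polynomial.C (c k) : F[X]).Monic :=
    fun k => monic_X_pow_sub_C _ (hm k).ne'
  have hzero : ∑ i, r i * ∏ k ∈ Finset.univ.erase i, (X ^ m k - Polynomial.C (c k)) = 0 := by
    refine eq_zero_of_dvd_of_degree_lt h ?_
    refine (degree_sum_le _ _).trans_lt ((Finset.sup_lt_iff ?_).2 fun i _ => ?_)
    · exact bot_lt_iff_ne_bot.2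
        (degree_ne_bot.2 (monic_prod_of_monic _ _ fun k _ => hmonic k).ne_zero)
    · rw [← Finset.mul_prod_erase Finset.univ _ (Finset.mem_univ i), degree_mul, degree_mul]
      refine WithBot.add_lt_add_right ?_ ?_
      · exact degree_ne_bot.2 (monic_prod_of_monic _ _ fun k _ => hmonic k).ne_zero
      · rw [degree_X_pow_sub_C (hm i)]
        exact hr i
  have heval := congrArg (Polynomial.eval 0) hzero
  simp only [eval_finsetSum, eval_mul, eval_prod, eval_sub, eval_pow, eval_X, eval_C, eval_zero,
    zero_pow (hm _).ne', zero_sub] at heval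
  have hprod : (∏ k, -c k) ≠ 0 := Finset.prod_ne_zero_iff.2 fun k _ => neg_ne_zero.2 (hc k)
  have h2 : (∏ k, -c k) * ∑ i, (c i)⁻¹ * (r i).coeff 0 = 0 := by
    -- Each denominator takes the value `-c i` at `0`, hence the overall sign.
    rw [Finset.mul_sum, ← neg_eq_zero, ← Finset.sum_neg_distrib, ← heval]
    refine Finset.sum_congr rfl fun i _ => ?_
    rw [← Finset.mul_prod_erase Finset.univ _ (Finset.mem_univ i), coeff_zero_eq_eval_zero]
    have := hc i
    field_simp
  exact (mul_eq_zero.1 h2).resolve_left hprod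

theorem sum_inv_mul_coeff_laurentMod_eq_zero {m : ι → ℕ} (hm : ∀ i, 0 < m i) {c : ι → F}
    (hc : ∀ i, c i ≠ 0) {w : ι → F[T;T⁻¹]}
    (h : toLaurent (∏ k, (X ^ m k - Polynomial.C (c k))) ∣
      ∑ i, w i * toLaurent (∏ k ∈ Finset.univ.erase i, (X ^ m k - Polynomial.C (c k)))) :
    ∑ i, (c i)⁻¹ * (laurentMod (m i) (c i) (w i)).coeff 0 = 0 := by
  refine sum_inv_mul_coeff_zero_eq_zero hm hc (fun i => degree_laurentMod_lt (hm i) _ _) ?_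
  apply dvd_of_toLaurent_dvd_toLaurent
  · rw [coeff_zero_eq_eval_zero, eval_prod]
    refine Finset.prod_ne_zero_iff.2 fun k _ => ?_
    simp [(hm k).ne', hc k]
  · rw [map_sum, ← dvd_sub_left h, ← Finset.sum_sub_distrib]
    refine Finset.dvd_sum fun i _ => ?_
    rw [map_mul, ← sub_mul, ← Finset.mul_prod_erase Finset.univ _ (Finset.mem_univ i), map_mul,
      toLaurent_X_pow_sub_C]
    exact mul_dvd_mul_right (dvd_toLaurent_laurentMod_sub (hm i) (hc i) _) _

end ProperFractions

/-! ### Factorizations of a diagonal matrix -/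

section Matrices

variable {R : Type*} [CommRing R] [IsDomain R] {n : Type*} [Fintype n] [DecidableEq n]

/-- `A * (B * A - d • 1) = 0`, and `A` can be cancelled because its determinant is nonzero. -/
theorem mul_eq_smul_one_comm_of_ne_zero {A B : Matrix n n R} {d : R} (hd : d ≠ 0)
    (h : A * B = d • 1) : B * A = d • 1 := by
  have hdet : A.det ≠ 0 := by
    have h1 := congrArg Matrix.det h
    rw [Matrix.det_mul, Matrix.det_smul, Matrix.det_one, mul_one] at h1
    exact left_ne_zero_of_mul (h1 ▸ pow_ne_zero _ hd)
  have h2 : A * (B * A - d • 1) = 0 := by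
    rw [mul_sub, ← mul_assoc, h, smul_mul_assoc, one_mul, mul_smul_comm, mul_one, sub_self]
  have h3 : A.det • (B * A - d • 1) = 0 := by
    rw [← one_mul (B * A - d • 1), ← smul_mul_assoc, ← Matrix.adjugate_mul, mul_assoc, h2,
      mul_zero]
  exact sub_eq_zero.1 ((smul_eq_zero.1 h3).resolve_left hdet)

/-- If `A * G` is the diagonal matrix `D`, then `∑ᵢ aᵢⱼ uᵢ / Dᵢ` is integral for every `u` in the
row space of `G`. -/
theorem prod_dvd_sum_mul_prod_erase {A G : Matrix n n R} {D : n → R} (hD : ∏ k, D k ≠ 0)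
    (h : A * G = Matrix.diagonal D) (z : n → R) (j : n) :
    ∏ k, D k ∣ ∑ i, (A i j * (Matrix.vecMul z G) i) * ∏ k ∈ Finset.univ.erase i, D k := by
  -- The second factor is `(∏ D) • A⁻¹`, free of denominators.
  have h1 : A * (G * Matrix.diagonal fun i => ∏ k ∈ Finset.univ.erase i, D k) =
      (∏ k, D k) • 1 := by
    rw [← mul_assoc, h, Matrix.diagonal_mul_diagonal, Matrix.smul_one_eq_diagonal]
    congr 1
    ext1 i
    exact Finset.mul_prod_erase Finset.univ D (Finset.mem_univ i)
  have h2 := mul_eq_smul_one_comm_of_ne_zero hD h1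
  have h3 := congrFun (congrArg (Matrix.vecMul z) h2) j
  rw [mul_assoc, Matrix.vecMul_smul, Matrix.vecMul_one, ← Matrix.vecMul_vecMul,
    ← Matrix.vecMul_vecMul] at h3
  refine ⟨z j, ?_⟩
  rw [← smul_eq_mul, ← Pi.smul_apply, ← h3, Matrix.vecMul, dotProduct]
  refine Finset.sum_congr rfl fun i _ => ?_
  rw [Matrix.vecMul_diagonal]
  ring

theorem upper_of_mul_upper_eq_diagonal {n : Type*} [Fintype n] [LinearOrder n]
    {A G : Matrix n n R} {D : n → R} (hG : ∀ i j, j < i → G i j = 0)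
    (hdiag : ∀ i, G i i ≠ 0) (h : A * G = Matrix.diagonal D) :
    ∀ i j, j < i → A i j = 0 := by
  intro i j
  induction j using WellFoundedLT.induction with
  | ind j ih =>
  intro hij
  have h1 := congrFun (congrFun h i) j
  rw [Matrix.mul_apply, Matrix.diagonal_apply_ne _ hij.ne', Finset.sum_eq_single j] at h1
  · exact (mul_eq_zero.1 h1).resolve_right (hdiag j)
  · intro k _ hk
    rcases lt_or_gt_of_ne hk with hk | hk
    · rw [ih k hk (hk.trans hij), zero_mul]
    · rw [hG k j hk, mul_zero]
  · simp

theorem mul_diag_eq_of_mul_upper_eq_diagonal {n : Type*} [Fintype n] [LinearOrder n]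
    {A G : Matrix n n R} {D : n → R} (hG : ∀ i j, j < i → G i j = 0)
    (hdiag : ∀ i, G i i ≠ 0) (h : A * G = Matrix.diagonal D) (i : n) :
    A i i * G i i = D i := by
  have h1 := congrFun (congrFun h i) i
  rwa [Matrix.mul_apply, Matrix.diagonal_apply_eq, Finset.sum_eq_single i] at h1
  · intro k _ hk
    rcases lt_or_gt_of_ne hk with hk | hk
    · rw [upper_of_mul_upper_eq_diagonal hG hdiag h i k hk, zero_mul]
    · rw [hG k i hk, mul_zero]
  · simp

end Matrices

/-! ### Codimension of a triangular row space -/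

section Codimension

variable {F : Type*} [Field F] {ι : Type*} [Fintype ι] [LinearOrder ι]

theorem exists_mem_span_degree_sub_lt {H : Matrix ι ι F[X]} (hH : ∀ i j, j < i → H i j = 0)
    (hdiag : ∀ i, H i i ≠ 0) (v : ι → F[X]) :
    ∃ r ∈ Submodule.span F[X] (Set.range fun i => H i),
      ∀ i, (v i - r i).degree < (H i i).degree := by
  have h : ∀ s : Finset ι, ∃ r ∈ Submodule.span F[X] (Set.range fun i => H i),
      ∀ i ∈ s, (v i - r i).degree < (H i i).degree := by
    intro s
    -- Columns are reduced in increasing order: row `a` vanishes left of column `a`, so earlier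
    -- remainders survive.
    induction s using Finset.induction_on_max with
    | empty => exact ⟨0, zero_mem _, by simp⟩
    | insert a s ha ih =>
      obtain ⟨r, hr, hrs⟩ := ih
      refine ⟨r + ((v a - r a) / H a a) • H a,
        add_mem hr (Submodule.smul_mem _ _ (Submodule.subset_span ⟨a, rfl⟩)), fun i hi => ?_⟩
      rw [Pi.add_apply, Pi.smul_apply, smul_eq_mul, ← sub_sub]
      rcases Finset.mem_insert.1 hi with rfl | hi
      · rw [mul_comm, ← EuclideanDomain.mod_eq_sub_mul_div]
        exact EuclideanDomain.mod_lt _ (hdiag i)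
      · rw [hH a i (ha i hi), mul_zero, sub_zero]
        exact hrs i hi
  obtain ⟨r, hr, h⟩ := h Finset.univ
  exact ⟨r, hr, fun i => h i (Finset.mem_univ i)⟩

/-- The row space of a triangular matrix has codimension at most the degree of the
determinant. -/
theorem finite_quotient_span_and_finrank_le {H : Matrix ι ι F[X]}
    (hH : ∀ i j, j < i → H i j = 0) (hdiag : ∀ i, H i i ≠ 0) {code : Submodule F[X] (ι → F[X])}
    (hcode : Submodule.span F[X] (Set.range fun i => H i) = code) :
    Module.Finite F ((ι → F[X]) ⧸ code.restrictScalars F) ∧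
      Module.finrank F ((ι → F[X]) ⧸ code.restrictScalars F) ≤ ∑ i, (H i i).natDegree := by
  subst hcode
  let f : (Π i, degreeLT F (H i i).natDegree) →ₗ[F] (ι → F[X]) :=
    LinearMap.pi fun i => (degreeLT F (H i i).natDegree).subtype ∘ₗ LinearMap.proj i
  have hsurj : Function.Surjective ((Submodule.mkQ ((Submodule.span F[X]
      (Set.range fun i => H i)).restrictScalars F)) ∘ₗ f) := by
    intro q
    obtain ⟨v, rfl⟩ := Submodule.mkQ_surjective _ q
    obtain ⟨r, hr, hv⟩ := exists_mem_span_degree_sub_lt hH hdiag v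
    refine ⟨fun i => ⟨v i - r i, mem_degreeLT.2 ?_⟩, ?_⟩
    · rw [← degree_eq_natDegree (hdiag i)]
      exact hv i
    · rw [LinearMap.comp_apply, ← sub_eq_zero, ← map_sub, Submodule.mkQ_apply,
        Submodule.Quotient.mk_eq_zero]
      convert! neg_mem hr using 1
      ext1 i
      simp [f]
  have : ∀ k : ℕ, Module.Finite F (degreeLT F k) := fun k =>
    Module.Finite.equiv (degreeLTEquiv F k).symm
  refine ⟨Module.Finite.of_surjective _ hsurj,
    (LinearMap.finrank_le_finrank_of_surjective hsurj).trans ?_⟩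
  rw [Module.finrank_pi_fintype]
  refine Finset.sum_le_sum fun i _ => ?_
  rw [(degreeLTEquiv F _).finrank_eq, Module.finrank_fin_fun]

end Codimension

/-! ### Dimension counting -/

section LinearAlgebra

variable {K V E : Type*} [Field K] [AddCommGroup V] [Module K V] [AddCommGroup E] [Module K E]
  {f : V →ₗ[K] E} {R : Submodule K V}

theorem mapQ_map_surjective (hf : Function.Surjective f) :
    Function.Surjective (R.mapQ (R.map f) f (Submodule.le_comap_map f R)) := by
  intro q
  obtain ⟨e, rfl⟩ := Submodule.mkQ_surjective _ q
  obtain ⟨v, rfl⟩ := hf e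
  exact ⟨R.mkQ v, rfl⟩

theorem finrank_le_finrank_quotient_add_finrank_map [FiniteDimensional K E]
    [Module.Finite K (V ⧸ R)]
    (hf : Function.Surjective f) :
    Module.finrank K E ≤ Module.finrank K (V ⧸ R) + Module.finrank K (R.map f) := by
  have h1 := LinearMap.finrank_le_finrank_of_surjective (mapQ_map_surjective (R := R) hf)
  have h2 := Submodule.finrank_quotient_add_finrank (R.map f)
  omega

/-- The surjection `V ⧸ R → E ⧸ f(R)` and `f(R) ≤ Z` give the reverse of `h`, so all inequalities
are equalities. The induced map is then injective, and it kills the class of every `v ∈ ker f`. -/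
theorem map_eq_and_ker_le_of_finrank_le [FiniteDimensional K E] [Module.Finite K (V ⧸ R)]
    (hf : Function.Surjective f)
    {Z : Submodule K E} (hZ : R.map f ≤ Z)
    (h : Module.finrank K (V ⧸ R) + Module.finrank K Z ≤ Module.finrank K E) :
    R.map f = Z ∧ LinearMap.ker f ≤ R := by
  have h1 := finrank_le_finrank_quotient_add_finrank_map (R := R) hf
  have h2 := Submodule.finrank_quotient_add_finrank (R.map f)
  have h3 := Submodule.finrank_mono hZ
  refine ⟨Submodule.eq_of_le_of_finrank_le hZ (by omega), fun v hv => ?_⟩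
  have hinj := (LinearMap.injective_iff_surjective_of_finrank_eq_finrank
    (f := R.mapQ (R.map f) f (Submodule.le_comap_map f R)) (by omega)).2 (mapQ_map_surjective hf)
  rw [← Submodule.Quotient.mk_eq_zero]
  apply hinj
  rw [Submodule.mapQ_apply, LinearMap.mem_ker.1 hv, Submodule.Quotient.mk_zero,
    map_zero]

theorem finrank_add_finrank_euclideanDual_le {κ : Type*} [Fintype κ] (W : Submodule K (κ → K)) :
    Module.finrank K W + Module.finrank K (euclideanDual W) ≤ Fintype.card κ := by
  classical
  have h1 : (euclideanDual W).map (dotProductEquiv K κ).toLinearMap ≤ W.dualAnnihilator := by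
    rintro _ ⟨a, ha, rfl⟩
    rw [Submodule.mem_dualAnnihilator]
    exact fun c hc => ha c hc
  have h2 := Submodule.finrank_mono h1
  have h3 := Subspace.finrank_add_finrank_dualAnnihilator_eq W
  rw [LinearEquiv.finrank_map_eq] at h2
  rw [Module.finrank_fintype_fun_eq_card] at h3
  omega

end LinearAlgebra

/-! ### Words and their dot products -/

section Words

variable {F : Type*} [Field F] {ℓ : ℕ} {m : Fin ℓ → ℕ} {lam : Fin ℓ → F}

theorem toWord_apply (v : Fin ℓ → F[X]) (p : Σ i : Fin ℓ, Fin (m i)) :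
    toWord m lam v p = (v p.1 %ₘ (X ^ m p.1 - Polynomial.C (lam p.1))).coeff p.2 :=
  rfl

theorem toWord_surjective (hm : ∀ i, 0 < m i) : Function.Surjective (toWord m lam) := by
  intro a
  refine ⟨fun i => ∑ k : Fin (m i), monomial k (a ⟨i, k⟩), funext fun ⟨i, k⟩ => ?_⟩
  have hdeg : (∑ k : Fin (m i), monomial k (a ⟨i, k⟩)).degree <
      (X ^ m i - Polynomial.C (lam i) : F[X]).degree := by
    rw [degree_X_pow_sub_C (hm i)]
    refine (degree_sum_le _ _).trans_lt
      ((Finset.sup_lt_iff (WithBot.bot_lt_coe _)).2 fun k _ => ?_)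
    exact (degree_monomial_le _ _).trans_lt (by exact_mod_cast k.2)
  rw [toWord_apply, (modByMonic_eq_self_iff (monic_X_pow_sub_C _ (hm i).ne')).2 hdeg,
    finsetSum_coeff, Finset.sum_eq_single k]
  · simp
  · intro b _ hb
    rw [coeff_monomial, if_neg fun h => hb (Fin.ext h)]
  · simp

theorem toWord_eq_zero_of_mem_blockSubmodule (hm : ∀ i, 0 < m i) {v : Fin ℓ → F[X]}
    (hv : v ∈ blockSubmodule m lam) : toWord m lam v = 0 := by
  ext ⟨i, k⟩
  have h := Ideal.mem_span_singleton.1 ((Submodule.mem_pi.1 hv) i (Set.mem_univ i))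
  rw [toWord_apply, (modByMonic_eq_zero_iff_dvd (monic_X_pow_sub_C _ (hm i).ne')).2 h, coeff_zero,
    Pi.zero_apply]

theorem toWord_dotProduct_toWord (hm : ∀ i, 0 < m i) (hlam : ∀ i, lam i ≠ 0)
    (v u : Fin ℓ → F[X]) :
    toWord m (fun i => (lam i)⁻¹) v ⬝ᵥ toWord m lam u =
      ∑ i, (laurentMod (m i) (lam i) (invert (toLaurent (v i)) * toLaurent (u i))).coeff 0 := by
  rw [dotProduct, Fintype.sum_sigma]
  refine Finset.sum_congr rfl fun i _ => ?_
  rw [← sum_coeff_laurentMod_mul_coeff_laurentMod (hm i) (hlam i)]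
  refine Finset.sum_congr rfl fun k _ => ?_
  rw [toWord_apply, toWord_apply, laurentMod_toLaurent (hm i) (hlam i),
    laurentMod_toLaurent (hm i) (inv_ne_zero (hlam i))]

theorem card_words : Fintype.card (Σ i : Fin ℓ, Fin (m i)) = ∑ i, m i := by
  simp

end Words

/-! ### The rows of `H` lie in the dual -/

section DualGenerator

variable {F : Type*} [Field F] {ℓ : ℕ} {m : Fin ℓ → ℕ} {lam : Fin ℓ → F}
  {G A : Matrix (Fin ℓ) (Fin ℓ) F[X]}

theorem natDegree_add_natDegree_of_mul_eq_X_pow_sub_C {k : ℕ} {c : F} (hk : 0 < k) {a g : F[X]}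
    (h : a * g = X ^ k - Polynomial.C c) : a.natDegree + g.natDegree = k := by
  have hne : a * g ≠ 0 := h ▸ (monic_X_pow_sub_C c hk.ne').ne_zero
  rw [← natDegree_mul (left_ne_zero_of_mul hne) (right_ne_zero_of_mul hne), h,
    natDegree_X_pow_sub_C]

theorem starMatrix_diag_eq {i : Fin ℓ}
    (h : (A i i).natDegree + (G i i).natDegree = m i) :
    starMatrix m G A i i = toLaurent (A i i).reverse := by
  -- The exponent is exactly the degree of `A i i`, so no negative powers occur.
  have h' : (m i : ℤ) - ((G i i).natDegree : ℤ) = ((A i i).natDegree : ℤ) := by omega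
  rw [toLaurent_reverse, starMatrix, Matrix.of_apply, h', mul_comm]

theorem toLaurent_doubleStarMatrix_of_le (hA : ∀ i j, j < i → A i j = 0)
    (hdeg : ∀ i, (A i i).natDegree + (G i i).natDegree = m i) (i j : Fin ℓ) (hij : j ≤ i) :
    toLaurent (doubleStarMatrix m lam G A i j) = starMatrix m G A i j := by
  rw [doubleStarMatrix, Matrix.of_apply, if_neg hij.not_gt]
  rcases hij.lt_or_eq with h | rfl
  · simp [starMatrix, hA i j h]
  · rw [starMatrix_diag_eq (hdeg j), trunc_toLaurent]

theorem doubleStarMatrix_of_lt (hA : ∀ i j, j < i → A i j = 0) {i j : Fin ℓ} (hij : j < i) :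
    doubleStarMatrix m lam G A i j = 0 := by
  rw [doubleStarMatrix, Matrix.of_apply, if_neg hij.not_gt, starMatrix, Matrix.of_apply, hA i j hij]
  simp

theorem doubleStarMatrix_diag {i : Fin ℓ} (h : (A i i).natDegree + (G i i).natDegree = m i) :
    doubleStarMatrix m lam G A i i = (A i i).reverse := by
  rw [doubleStarMatrix, Matrix.of_apply, if_neg (lt_irrefl i), starMatrix_diag_eq h,
    trunc_toLaurent]

theorem dvd_toLaurent_doubleStarMatrix_sub (hm : ∀ i, 0 < m i) (hlam : ∀ i, lam i ≠ 0)
    (hA : ∀ i j, j < i → A i j = 0) (hdeg : ∀ i, (A i i).natDegree + (G i i).natDegree = m i)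
    (i j : Fin ℓ) :
    (T (m i : ℤ) - LaurentPolynomial.C (lam i)⁻¹ : F[T;T⁻¹]) ∣
      toLaurent (doubleStarMatrix m lam G A i j) - starMatrix m G A i j := by
  rcases le_or_gt j i with hij | hij
  · rw [toLaurent_doubleStarMatrix_of_le hA hdeg i j hij, sub_self]
    exact dvd_zero _
  · rw [doubleStarMatrix, Matrix.of_apply, if_pos hij]
    exact dvd_toLaurent_laurentMod_sub (hm i) (inv_ne_zero (hlam i)) _

/-- Inversion sends `T k - c⁻¹` to a unit times `T k - c`. -/
theorem T_sub_C_dvd_invert {k : ℕ} {c : F} (hc : c ≠ 0) {f : F[T;T⁻¹]}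
    (h : (T (k : ℤ) - LaurentPolynomial.C c⁻¹ : F[T;T⁻¹]) ∣ f) :
    (T (k : ℤ) - LaurentPolynomial.C c : F[T;T⁻¹]) ∣ invert f := by
  obtain ⟨e, rfl⟩ := h
  have h1 : (T (k : ℤ) * T (-(k : ℤ)) : F[T;T⁻¹]) = 1 := by rw [← T_add, add_neg_cancel, T_zero]
  have h2 : (LaurentPolynomial.C c * LaurentPolynomial.C c⁻¹ : F[T;T⁻¹]) = 1 := by
    rw [← map_mul, mul_inv_cancel₀ hc, map_one]
  refine ⟨-(LaurentPolynomial.C c⁻¹ * T (-(k : ℤ)) * invert e), ?_⟩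
  rw [map_mul, map_sub, invert_T, invert_C]
  linear_combination (LaurentPolynomial.C c⁻¹ * invert e) * h1 - T (-(k : ℤ)) * invert e * h2

/-- Inverting `A*` yields `x^{d_j - m_i} a_ij`, and `x^{-m_i} ≡ λ_i⁻¹`. This scalar is the weight
appearing in `sum_inv_mul_coeff_laurentMod_eq_zero`. -/
theorem T_sub_C_dvd_invert_doubleStarMatrix_sub (hm : ∀ i, 0 < m i) (hlam : ∀ i, lam i ≠ 0)
    (hA : ∀ i j, j < i → A i j = 0) (hdeg : ∀ i, (A i i).natDegree + (G i i).natDegree = m i)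
    (i j : Fin ℓ) :
    (T (m i : ℤ) - LaurentPolynomial.C (lam i) : F[T;T⁻¹]) ∣
      invert (toLaurent (doubleStarMatrix m lam G A i j)) -
        LaurentPolynomial.C (lam i)⁻¹ * (T ((G j j).natDegree : ℤ) * toLaurent (A i j)) := by
  have h := T_sub_C_dvd_invert (hlam i) (dvd_toLaurent_doubleStarMatrix_sub hm hlam hA hdeg i j)
  have hstar : invert (starMatrix m G A i j) =
      T (-(m i : ℤ)) * (T ((G j j).natDegree : ℤ) * toLaurent (A i j)) := by
    rw [starMatrix, Matrix.of_apply, map_mul, invert_T, ← mul_assoc, ← T_add, neg_sub,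
      sub_eq_neg_add]
    congr 1
    exact involutive_invert _
  have h1 : (T (m i : ℤ) * T (-(m i : ℤ)) : F[T;T⁻¹]) = 1 := by
    rw [← T_add, add_neg_cancel, T_zero]
  have h2 : (LaurentPolynomial.C (lam i) * LaurentPolynomial.C (lam i)⁻¹ : F[T;T⁻¹]) = 1 := by
    rw [← map_mul, mul_inv_cancel₀ (hlam i), map_one]
  rw [map_sub, hstar] at h
  convert! dvd_sub h (dvd_mul_right (T (m i : ℤ) - LaurentPolynomial.C (lam i) : F[T;T⁻¹])
    (LaurentPolynomial.C (lam i)⁻¹ * T (-(m i : ℤ)) *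
      (T ((G j j).natDegree : ℤ) * toLaurent (A i j)))) using 1
  linear_combination
    LaurentPolynomial.C (lam i)⁻¹ * (T ((G j j).natDegree : ℤ) * toLaurent (A i j)) * h1
      - T (-(m i : ℤ)) * (T ((G j j).natDegree : ℤ) * toLaurent (A i j)) * h2

theorem toWord_row_dotProduct_toWord_eq_zero (hm : ∀ i, 0 < m i) (hlam : ∀ i, lam i ≠ 0)
    (hupper : ∀ i j, j < i → A i j = 0)
    (hdeg : ∀ i, (A i i).natDegree + (G i i).natDegree = m i)
    (hA : A * G = blockDiagonal m lam) (f : F[X]) (j : Fin ℓ) (z : Fin ℓ → F[X]) :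
    toWord m (fun i => (lam i)⁻¹) (f • (doubleStarMatrix m lam G A).transpose j) ⬝ᵥ
      toWord m lam (Matrix.vecMul z G) = 0 := by
  rw [toWord_dotProduct_toWord hm hlam, ← sum_inv_mul_coeff_laurentMod_eq_zero hm hlam
    (w := fun i => invert (toLaurent f) * T ((G j j).natDegree : ℤ) *
      toLaurent (A i j * (Matrix.vecMul z G) i))]
  · refine Finset.sum_congr rfl fun i _ => ?_
    rw [← coeff_C_mul, ← laurentMod_C_mul]
    congr 1
    apply laurentMod_eq_of_dvd_sub (hm i) (hlam i)
    rw [Pi.smul_apply, smul_eq_mul, Matrix.transpose_apply, map_mul, map_mul, map_mul]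
    convert! (T_sub_C_dvd_invert_doubleStarMatrix_sub hm hlam hupper hdeg i j).mul_left
      (invert (toLaurent f) * toLaurent ((Matrix.vecMul z G) i)) using 1
    ring
  · have h := (map_dvd toLaurent (prod_dvd_sum_mul_prod_erase
        (Finset.prod_ne_zero_iff.2 fun k _ => (monic_X_pow_sub_C (lam k) (hm k).ne').ne_zero)
        hA z j)).mul_left
      (invert (toLaurent f) * T ((G j j).natDegree : ℤ))
    convert! h using 1
    rw [map_sum, Finset.mul_sum]
    refine Finset.sum_congr rfl fun i _ => ?_
    rw [map_mul toLaurent (A i j * _), mul_assoc]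

theorem wordCode_span_le_euclideanDual (hm : ∀ i, 0 < m i) (hlam : ∀ i, lam i ≠ 0)
    (hupper : ∀ i j, j < i → A i j = 0)
    (hdeg : ∀ i, (A i i).natDegree + (G i i).natDegree = m i)
    (hA : A * G = blockDiagonal m lam) :
    wordCode m (fun i => (lam i)⁻¹)
        (Submodule.span F[X] (Set.range fun i => (doubleStarMatrix m lam G A).transpose i)) ≤
      euclideanDual (wordCode m lam (Submodule.span F[X] (Set.range fun i => G i))) := by
  rintro _ ⟨v, hv, rfl⟩ _ ⟨u, hu, rfl⟩
  obtain ⟨y, rfl⟩ := (Submodule.mem_span_range_iff_exists_fun F[X]).1 hv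
  obtain ⟨z, rfl⟩ := (Submodule.mem_span_range_iff_exists_fun F[X]).1 hu
  rw [map_sum, sum_dotProduct]
  refine Finset.sum_eq_zero fun j _ => ?_
  rw [← Matrix.vecMul_eq_sum]
  exact toWord_row_dotProduct_toWord_eq_zero hm hlam hupper hdeg hA (y j) j z

end DualGenerator

end MultiTwisted

/-! ### Equality with the dual -/

theorem mainTheorem1 {F : Type*} [Field F] [Finite F] (ℓ : ℕ)
    (m : Fin ℓ → ℕ) (hm : ∀ i, 0 < m i) (lam : Fin ℓ → F) (hlam : ∀ i, lam i ≠ 0)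
    (code : Submodule F[X] (Fin ℓ → F[X])) (hcode : MultiTwisted.IsMTCode m lam code)
    (G A : Matrix (Fin ℓ) (Fin ℓ) F[X]) (hG : MultiTwisted.IsReducedGPM G code)
    (hA : A * G = MultiTwisted.blockDiagonal m lam) :
    (∀ i j, j ≤ i →
      toLaurent (MultiTwisted.doubleStarMatrix m lam G A i j) =
        MultiTwisted.starMatrix m G A i j) ∧
    MultiTwisted.IsGPMOfWordCode m (fun i => (lam i)⁻¹)
      (MultiTwisted.doubleStarMatrix m lam G A).transpose
      (MultiTwisted.euclideanDual (MultiTwisted.wordCode m lam code)) := by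
  have hGdiag : ∀ i, G i i ≠ 0 := fun i => (hG.monic i).ne_zero
  have hupper := MultiTwisted.upper_of_mul_upper_eq_diagonal hG.upper hGdiag hA
  have hAG := MultiTwisted.mul_diag_eq_of_mul_upper_eq_diagonal hG.upper hGdiag hA
  have hdeg : ∀ i, (A i i).natDegree + (G i i).natDegree = m i :=
    fun i => MultiTwisted.natDegree_add_natDegree_of_mul_eq_X_pow_sub_C (hm i) (hAG i)
  have hAdiag : ∀ i, A i i ≠ 0 := fun i h => by
    have h1 := hAG i
    rw [h, zero_mul] at h1
    exact (monic_X_pow_sub_C (lam i) (hm i).ne').ne_zero h1.symm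
  refine ⟨MultiTwisted.toLaurent_doubleStarMatrix_of_le hupper hdeg, ?_⟩
  set H := (MultiTwisted.doubleStarMatrix m lam G A).transpose with hH
  have hHdiag : ∀ i, H i i = (A i i).reverse :=
    fun i => MultiTwisted.doubleStarMatrix_diag (hdeg i)
  obtain ⟨_, hcodim⟩ := MultiTwisted.finite_quotient_span_and_finrank_le hG.upper hGdiag hG.isGPM
  obtain ⟨_, hdualcodim⟩ : Module.Finite F ((Fin ℓ → F[X]) ⧸
        (Submodule.span F[X] (Set.range fun i => H i)).restrictScalars F) ∧
      Module.finrank F ((Fin ℓ → F[X]) ⧸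
        (Submodule.span F[X] (Set.range fun i => H i)).restrictScalars F) ≤
          ∑ i, (H i i).natDegree :=
    -- `H` is lower triangular, hence upper triangular for the reversed order.
    MultiTwisted.finite_quotient_span_and_finrank_le (ι := (Fin ℓ)ᵒᵈ) (H := H)
      (fun i j hij => MultiTwisted.doubleStarMatrix_of_lt hupper (i := j) (j := i) hij)
      (fun i => by rw [hHdiag i]; exact reverse_eq_zero.not.2 (hAdiag i)) rfl
  have hdegH : ∑ i, (H i i).natDegree + ∑ i, (G i i).natDegree ≤ ∑ i, m i := by
    rw [← Finset.sum_add_distrib]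
    refine Finset.sum_le_sum fun i _ => ?_
    rw [hHdiag, ← hdeg i]
    exact Nat.add_le_add_right (reverse_natDegree_le _) _
  have hle : MultiTwisted.wordCode m (fun i => (lam i)⁻¹)
      (Submodule.span F[X] (Set.range fun i => H i)) ≤ _ :=
    MultiTwisted.wordCode_span_le_euclideanDual hm hlam hupper hdeg hA
  rw [show Submodule.span F[X] (Set.range fun i => G i) = code from hG.isGPM] at hle
  have hdim := MultiTwisted.finrank_add_finrank_euclideanDual_le
    (MultiTwisted.wordCode m lam code)
  have hdimcode := MultiTwisted.finrank_le_finrank_quotient_add_finrank_map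
    (R := code.restrictScalars F) (MultiTwisted.toWord_surjective (lam := lam) hm)
  change _ ≤ _ + Module.finrank F (MultiTwisted.wordCode m lam code) at hdimcode
  have hcard := Module.finrank_fintype_fun_eq_card F (η := Σ i : Fin ℓ, Fin (m i))
  rw [MultiTwisted.card_words] at hcard hdim
  -- The codimension bounds for `G` and `H` sum to at most `n`, and `dim C + dim C^⊥ ≤ n`; together
  -- these give the hypothesis. The kernel part makes the row space of `H` contain the block
  -- submodule.
  obtain ⟨heq, hker⟩ := MultiTwisted.map_eq_and_ker_le_of_finrank_le
    (MultiTwisted.toWord_surjective hm) hle (by omega)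
  exact ⟨_, fun v hv => hker (LinearMap.mem_ker.2
    (MultiTwisted.toWord_eq_zero_of_mem_blockSubmodule hm hv)), heq, rfl⟩
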